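/- Let $d\ge 2$ and let $\Omega\subset\mathbb{R}^d$ be a bounded Lipschitz domain, that is, a bounded open set with finitely many connected components whose boundary is locally the graph of a Lipschitz function, with $\Omega$ lying locally on one side of it. Let $\sigma$ be the surface measure on $\partial\Omega$ (the $(d-1)$-dimensional Hausdorff measure, normalised to agree with Lebesgue measure on $\mathbb{R}^{d-1}$). For $\alpha\in\mathbb{C}$ call $\lambda\in\mathbb{C}$ an eigenvalue of the Robin Laplacian with parameter $\alpha$ (that is, of $-\Delta u=\lambda u$ in $\Omega$, $\frac{\partial u}{\partial\nu}+\alpha u=0$ on $\partial\Omega$, where $\nu$ is the outer unit normal) if there is a nonzero complex-valued $u\in H^1(\Omega)$ such that $$\int_\Omega \nabla u\cdot\overline{\nabla v}\,dx+\int_{\partial\Omega}\alpha\,u\,\overline{v}\,d\sigma=\lambda\int_\Omega u\,\overline{v}\,dx\qquad\text{for all } v\in H^1(\Omega),$$ where $u$ and $v$ are understood as traces in the boundary integral. Then there exist constants $c_1\ge 1$ and $c_2>0$, depending only on $\Omega$, such that for every real $\alpha<0$ every eigenvalue $\lambda$ of the Robin Laplacian with parameter $\alpha$ is real and satisfies $$\lambda\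 \ge\ -c_1\alpha^2-c_2|\alpha|\ =\ -c_1\alpha^2+c_2\alpha .$$ If moreover $\Omega$ has $C^2$ boundary, that is, if $\partial\Omega$ is locally the graph of a $C^2$ function with $\Omega$ lying locally on one side of it, then one may choose $c_1=1$ (with some $c_2>0$ depending only on $\Omega$). -/

import Mathlib

open MeasureTheory Filter Topology
open scoped ContDiff ComplexConjugate

noncomputable section

/-- The boundary of `Ω ⊆ ℝᵈ` is locally the graph of a function belonging to the class `P`, with `Ω`
lying locally on one side of it: around every boundary point `z` there are orthonormal coordinates
`T x = (x', x_d) ∈ ℝᵈ⁻¹ × ℝ`, an open neighbourhood `U` of `z` and a function `g` of class `P` such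
that `Ω ∩ U = {x ∈ U : x_d < g x'}`. It is used for `d ≥ 2`. -/
def HasGraphBoundary {d : ℕ} (P : (EuclideanSpace ℝ (Fin (d - 1)) → ℝ) → Prop)
    (Ω : Set (EuclideanSpace ℝ (Fin d))) : Prop :=
  ∀ z ∈ frontier Ω,
    ∃ (T : EuclideanSpace ℝ (Fin d) ≃ₗᵢ[ℝ] WithLp 2 (EuclideanSpace ℝ (Fin (d - 1)) × ℝ))
      (U : Set (EuclideanSpace ℝ (Fin d))) (g : EuclideanSpace ℝ (Fin (d - 1)) → ℝ),
      IsOpen U ∧ z ∈ U ∧ P g ∧ ∀ x ∈ U, x ∈ Ω ↔ (T x).snd < g (T x).fst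

/-- A bounded Lipschitz domain: a bounded open set with finitely many connected components whose
boundary is locally the graph of a Lipschitz function. -/
structure IsBoundedLipschitzDomain {d : ℕ} (Ω : Set (EuclideanSpace ℝ (Fin d))) : Prop where
  isOpen : IsOpen Ω
  isBounded : Bornology.IsBounded Ω
  finite_components : Finite (ConnectedComponents Ω)
  lipschitz_boundary : HasGraphBoundary (fun g => ∃ K, LipschitzWith K g) Ω

/-- The boundary of `Ω` is of class `C²`. -/
def HasC2Boundary {d : ℕ} (Ω : Set (EuclideanSpace ℝ (Fin d))) : Prop :=
  HasGraphBoundary (fun g => ContDiff ℝ 2 g) Ω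

/-- The surface measure `σ` on `∂Ω`: the `(d-1)`-dimensional Hausdorff measure, normalised so that
it agrees with Lebesgue measure on `(d-1)`-dimensional Euclidean spaces, restricted to `∂Ω`. -/
def surfaceMeasure {d : ℕ} (Ω : Set (EuclideanSpace ℝ (Fin d))) :
    Measure (EuclideanSpace ℝ (Fin d)) :=
  (Measure.euclideanHausdorffMeasure (d - 1)).restrict (frontier Ω)

/-- The classical partial derivative `∂ᵢ φ`. -/
def partialDeriv {d : ℕ} {F : Type*} [NormedAddCommGroup F] [NormedSpace ℝ F] (i : Fin d)
    (φ : EuclideanSpace ℝ (Fin d) → F) (x : EuclideanSpace ℝ (Fin d)) : F :=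
  fderiv ℝ φ x (EuclideanSpace.single i 1)

/-- (A representative of) an element of the complex Sobolev space `H¹(Ω)`: a function in
`L²(Ω; ℂ)` together with its weak partial derivatives, which are in `L²(Ω; ℂ)` too. -/
structure SobolevH1 {d : ℕ} (Ω : Set (EuclideanSpace ℝ (Fin d))) where
  val : EuclideanSpace ℝ (Fin d) → ℂ
  grad : Fin d → EuclideanSpace ℝ (Fin d) → ℂ
  memLp_val : MemLp val 2 (volume.restrict Ω)
  memLp_grad : ∀ i, MemLp (grad i) 2 (volume.restrict Ω)
  weak_grad : ∀ φ : EuclideanSpace ℝ (Fin d) → ℝ, ContDiff ℝ ∞ φ → HasCompactSupport φ →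
    tsupport φ ⊆ Ω → ∀ i,
      ∫ x in Ω, partialDeriv i φ x • val x = -∫ x in Ω, φ x • grad i x

/-- `g ∈ L²(∂Ω)` is the trace of `u ∈ H¹(Ω)`: the trace operator is the continuous extension to
`H¹(Ω)` of the restriction to `∂Ω` of functions that are smooth up to the boundary, so `(u, g)` is
the limit in `H¹(Ω) × L²(∂Ω)` of pairs `(φₙ|_Ω, φₙ|_∂Ω)` with `φₙ` smooth on `ℝᵈ`. -/
def IsTrace {d : ℕ} {Ω : Set (EuclideanSpace ℝ (Fin d))} (u : SobolevH1 Ω)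
    (g : EuclideanSpace ℝ (Fin d) → ℂ) : Prop :=
  MemLp g 2 (surfaceMeasure Ω) ∧
    ∃ φ : ℕ → EuclideanSpace ℝ (Fin d) → ℂ, (∀ n, ContDiff ℝ ∞ (φ n)) ∧
      Tendsto (fun n => eLpNorm (φ n - u.val) 2 (volume.restrict Ω)) atTop (𝓝 0) ∧
      (∀ i, Tendsto (fun n => eLpNorm (partialDeriv i (φ n) - u.grad i) 2 (volume.restrict Ω))
        atTop (𝓝 0)) ∧
      Tendsto (fun n => eLpNorm (φ n - g) 2 (surfaceMeasure Ω)) atTop (𝓝 0)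

/-- The Robin form `a_α[u, v] = ∫_Ω ∇u · conj(∇v) dx + ∫_∂Ω α u conj(v) dσ`, where `g` and `h` are
the traces of `u` and `v`. -/
def robinForm {d : ℕ} {Ω : Set (EuclideanSpace ℝ (Fin d))} (α : ℂ) (u v : SobolevH1 Ω)
    (g h : EuclideanSpace ℝ (Fin d) → ℂ) : ℂ :=
  (∫ x in Ω, ∑ i, u.grad i x * conj (v.grad i x)) +
    ∫ y, α * g y * conj (h y) ∂(surfaceMeasure Ω)

/-- The graph of the Robin Laplacian, the operator on `L²(Ω)` associated with the form `a_α`: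
`u ∈ H¹(Ω)` is in its domain and is mapped to `f ∈ L²(Ω)` if `a_α[u, v] = (f, v)` for all
`v ∈ H¹(Ω)`. -/
def IsRobinLaplacian {d : ℕ} {Ω : Set (EuclideanSpace ℝ (Fin d))} (α : ℂ) (u : SobolevH1 Ω)
    (f : EuclideanSpace ℝ (Fin d) → ℂ) : Prop :=
  MemLp f 2 (volume.restrict Ω) ∧
    ∃ g, IsTrace u g ∧ ∀ (v : SobolevH1 Ω) (h : EuclideanSpace ℝ (Fin d) → ℂ), IsTrace v h →
      robinForm α u v g h = ∫ x in Ω, f x * conj (v.val x)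

/-- `lam` is an eigenvalue of the Robin Laplacian on `Ω` with parameter `α`. -/
def IsRobinEigenvalue {d : ℕ} (Ω : Set (EuclideanSpace ℝ (Fin d))) (α lam : ℂ) : Prop :=
  ∃ u : SobolevH1 Ω, ¬ (u.val =ᵐ[volume.restrict Ω] 0) ∧
    IsRobinLaplacian α u (fun x => lam * u.val x)

end

open scoped ENNReal NNReal InnerProductSpace

/-! ### Upper bounds for the Hausdorff measure of graphs. -/

section SurfaceArea

/-! Everything rests on a trace inequality `∫_∂Ω |φ|² ≤ ∫_Ω (C |φ|² + 2 M |φ| |∇φ|)` for smooth `φ`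
(`exists_trace_inequality`). Multiplying by `β = -α` and using `2 β M |φ| |∇φ| ≤ β² M² |φ|² + |∇φ|²`
absorbs the whole boundary term of the Robin form into the gradient term, up to `(β C + β² M²)
‖φ‖²`. This passes to the limit for `H¹` functions and their traces, and testing the eigenvalue
equation with `u` itself gives reality and `λ ≥ -M² α² + C α`. So `c₁` is governed by `M` alone.

The trace inequality is the divergence theorem for `ψ X` with `ψ = |φ|²` and `X` a field transversal
to the boundary: `C` bounds the divergence of `X`, and `M` the length of `X` relative to its normal
component. On a Lipschitz graph the vertical unit field serves; its divergence vanishes and the area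
density is at most `(1 + K)^(d-1)`, so some `M` exists. On a `C²` graph the unit normal, extended
constantly in the vertical direction, is `C¹` of length one, whence `M = 1`
(`exists_integral_graph_area_le`). A partition of unity globalises: derivatives of the cutoffs
affect only `C`, because the cutoffs sum to at most one.

Surface measure only has to be bounded from above, so one half of the area formula for graphs is
enough (`euclideanHausdorffMeasure_image_graph_le`). -/

theorem LipschitzOnWith.euclideanHausdorffMeasure_image_le {X Y : Type*}
    [MetricSpace X] [MeasurableSpace X] [BorelSpace X]
    [MetricSpace Y] [MeasurableSpace Y] [BorelSpace Y] {f : X → Y} {s : Set X} {K : ℝ≥0}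
    (hf : LipschitzOnWith K f s) (n : ℕ) :
    Measure.euclideanHausdorffMeasure n (f '' s) ≤
      (K : ℝ≥0∞) ^ n * Measure.euclideanHausdorffMeasure n s := by
  simp only [Measure.euclideanHausdorffMeasure_def, Measure.smul_apply, ENNReal.smul_def,
    smul_eq_mul]
  have h := hf.hausdorffMeasure_image_le (d := n) (by positivity)
  rw [ENNReal.rpow_natCast] at h
  calc _ ≤ _ := mul_le_mul_right h _
    _ = _ := by ring

variable {n : ℕ} {Y : Type*} [MetricSpace Y] [MeasurableSpace Y] [BorelSpace Y]

/-- The map `f ∘ b⁻¹` is `K`-Lipschitz on `b '' s`, a set of volume `|det b| * volume s`. Measuring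
distances through `b` keeps the exact Jacobian, which a Lipschitz bound on `f` alone would lose. -/
theorem euclideanHausdorffMeasure_image_le_of_dist_le {f : EuclideanSpace ℝ (Fin n) → Y}
    {b : EuclideanSpace ℝ (Fin n) →ₗ[ℝ] EuclideanSpace ℝ (Fin n)} (hb : Function.Injective b)
    {s : Set (EuclideanSpace ℝ (Fin n))} {K : ℝ≥0}
    (h : ∀ x ∈ s, ∀ y ∈ s, dist (f x) (f y) ≤ K * dist (b x) (b y)) :
    Measure.euclideanHausdorffMeasure n (f '' s) ≤
      (K : ℝ≥0∞) ^ n * (ENNReal.ofReal |LinearMap.det b| * volume s) := by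
  have hinv : ∀ x, Function.invFun b (b x) = x := Function.leftInverse_invFun hb
  have hl : LipschitzOnWith K (f ∘ Function.invFun b) (b '' s) := by
    refine LipschitzOnWith.of_dist_le_mul ?_
    rintro _ ⟨x, hx, rfl⟩ _ ⟨y, hy, rfl⟩
    simpa [hinv] using h x hx y hy
  have h2 := hl.euclideanHausdorffMeasure_image_le n
  rw [EuclideanSpace.euclideanHausdorffMeasure_eq_volume, Measure.addHaar_image_linearMap,
    Set.image_image] at h2
  simpa [hinv] using h2

/-- The positive square root of `1 + p ⊗ p`. -/
theorem exists_linearMap_norm_sq_eq_add_inner_sq {E : Type*} [NormedAddCommGroup E]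
    [InnerProductSpace ℝ E] [FiniteDimensional ℝ E] (p : E) :
    ∃ b : E →ₗ[ℝ] E, (∀ v, ‖b v‖ ^ 2 = ‖v‖ ^ 2 + ⟪p, v⟫_ℝ ^ 2) ∧
      LinearMap.det b = √(1 + ‖p‖ ^ 2) := by
  set w := √(1 + ‖p‖ ^ 2) with hw
  have hw2 : w ^ 2 = 1 + ‖p‖ ^ 2 := Real.sq_sqrt (by positivity)
  have hw0 : 0 ≤ w := Real.sqrt_nonneg _
  -- The root is the identity on `p⊥` and scales `p` by `w`; the coefficient is `(w - 1) / ‖p‖² = 1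
  -- / (1 + w)`, which also makes sense for `p = 0`.
  refine ⟨LinearMap.transvection (innerₗ E p) ((1 + w)⁻¹ • p), fun v => ?_, ?_⟩
  · rw [LinearMap.transvection.apply, norm_add_sq_real]
    simp only [innerₗ_apply_apply, inner_smul_right, norm_smul, Real.norm_eq_abs, mul_pow, sq_abs,
      real_inner_comm p v]
    have : (1 + w)⁻¹ * (1 + w) = 1 := inv_mul_cancel₀ (by positivity)
    generalize (1 + w)⁻¹ = c at *
    have hp : ‖p‖ ^ 2 = w ^ 2 - 1 := by linarith
    rw [hp]
    have : 2 * c + c ^ 2 * (w ^ 2 - 1) = 1 := by linear_combination (1 + c * w - c) * this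
    linear_combination ⟪p, v⟫_ℝ ^ 2 * this
  · rw [LinearMap.transvection.det]
    simp only [innerₗ_apply_apply, inner_smul_right, real_inner_self_eq_norm_sq]
    have : ‖p‖ ^ 2 = (w - 1) * (1 + w) := by linear_combination -hw2
    rw [this]
    field_simp
    ring

theorem euclideanHausdorffMeasure_image_graph_le_of_lipschitz {f : EuclideanSpace ℝ (Fin n) → Y}
    {g : EuclideanSpace ℝ (Fin n) → ℝ} {K : ℝ≥0} (hg : LipschitzWith K g)
    (hf : ∀ x y, dist (f x) (f y) ^ 2 = dist x y ^ 2 + dist (g x) (g y) ^ 2)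
    (s : Set (EuclideanSpace ℝ (Fin n))) :
    Measure.euclideanHausdorffMeasure n (f '' s) ≤ ((1 + K : ℝ≥0) : ℝ≥0∞) ^ n * volume s := by
  have hl : LipschitzOnWith (1 + K) f s := by
    refine LipschitzOnWith.of_dist_le_mul fun x _ y _ => ?_
    refine abs_le_of_sq_le_sq' ?_ (by positivity) |>.2
    rw [hf]
    have h := hg.dist_le_mul x y
    have h2 : dist (g x) (g y) ^ 2 ≤ (K * dist x y) ^ 2 := by gcongr
    push_cast
    nlinarith [mul_nonneg K.coe_nonneg (sq_nonneg (dist x y))]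
  simpa [EuclideanSpace.euclideanHausdorffMeasure_eq_volume] using
    hl.euclideanHausdorffMeasure_image_le n

/-- Near `x₀` the graph is almost its tangent plane, on which distances are exactly `‖b v‖` with `b`
the root of `1 + p ⊗ p`. Strict differentiability makes `f ∘ b⁻¹` there `(1 + ε)`-Lipschitz, costing
`(1 + ε)^n`; the last factor pays for replacing the density at `x₀` by the density at `x`. -/
theorem eventually_euclideanHausdorffMeasure_image_graph_le {f : EuclideanSpace ℝ (Fin n) → Y}
    {g : EuclideanSpace ℝ (Fin n) → ℝ} (hg : ContDiff ℝ 1 g)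
    (hf : ∀ x y, dist (f x) (f y) ^ 2 = dist x y ^ 2 + dist (g x) (g y) ^ 2)
    {ε : ℝ} (hε : 0 < ε) (x₀ : EuclideanSpace ℝ (Fin n)) :
    ∃ W ∈ 𝓝 x₀, ∀ s ⊆ W, MeasurableSet s →
      Measure.euclideanHausdorffMeasure n (f '' s) ≤ ENNReal.ofReal ((1 + ε) ^ (n + 1)) *
        ∫⁻ x in s, ENNReal.ofReal √(1 + ‖gradient g x‖ ^ 2) := by
  set p := gradient g x₀ with hp
  have hgc : Continuous (gradient g) :=
    (InnerProductSpace.toDual ℝ _).symm.continuous.comp (hg.continuous_fderiv one_ne_zero)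
  have hstrict : HasStrictFDerivAt g (fderiv ℝ g x₀) x₀ :=
    hg.contDiffAt.hasStrictFDerivAt one_ne_zero
  obtain ⟨b, hb, hdet⟩ := exists_linearMap_norm_sq_eq_add_inner_sq p
  have hbinj : Function.Injective b := by
    rw [injective_iff_map_eq_zero]
    intro v hv
    have := hb v
    rw [hv] at this
    simp only [norm_zero] at this
    have : ‖v‖ ^ 2 = 0 := by nlinarith [sq_nonneg ‖v‖, sq_nonneg ⟪p, v⟫_ℝ]
    simpa using this
  obtain ⟨V, hV, hVa⟩ := hstrict.approximates_deriv_on_nhds (c := ε.toNNReal)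
    (Or.inr (Real.toNNReal_pos.2 hε))
  have hK : ((1 + ε).toNNReal : ℝ) = 1 + ε := Real.coe_toNNReal _ (by positivity)
  have hcw : Continuous fun x => √(1 + ‖gradient g x‖ ^ 2) := by fun_prop
  have hwpos : ∀ x, 0 < √(1 + ‖gradient g x‖ ^ 2) := fun x => Real.sqrt_pos.2 (by positivity)
  have hW : ∀ᶠ x in 𝓝 x₀, √(1 + ‖p‖ ^ 2) < (1 + ε) * √(1 + ‖gradient g x‖ ^ 2) := by
    refine ContinuousAt.eventually_lt continuousAt_const (by fun_prop) ?_
    nlinarith [hwpos x₀]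
  refine ⟨_, inter_mem hV hW, fun s hs hsm => ?_⟩
  have hdist : ∀ x ∈ s, ∀ y ∈ s, dist (f x) (f y) ≤
      (1 + ε).toNNReal * dist (b x) (b y) := by
    intro x hx y hy
    refine abs_le_of_sq_le_sq' ?_ (by positivity) |>.2
    rw [mul_pow, dist_eq_norm (b x), ← map_sub, hb, hf, hK]
    have h1 := hVa x (hs hx).1 y (hs hy).1
    have h2 : fderiv ℝ g x₀ (x - y) = ⟪p, x - y⟫_ℝ := by
      rw [hp, gradient, InnerProductSpace.toDual_symm_apply]
    rw [h2, Real.coe_toNNReal _ hε.le, Real.norm_eq_abs, ← dist_eq_norm x y] at h1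
    rw [← dist_eq_norm x y, Real.dist_eq, sq_abs]
    set a := dist x y
    have ha : 0 ≤ a := dist_nonneg
    set q := ⟪p, x - y⟫_ℝ
    have h3 : |g x - g y| ≤ |q| + ε * a := by
      have := abs_sub_abs_le_abs_sub (g x - g y) q
      linarith
    have h4 : |g x - g y| ^ 2 ≤ (|q| + ε * a) ^ 2 := by gcongr
    rw [sq_abs] at h4
    rw [← sq_abs q]
    nlinarith [mul_nonneg hε.le (sq_nonneg (a - |q|)), mul_nonneg hε.le (sq_nonneg a),
      mul_nonneg hε.le (sq_nonneg |q|), mul_nonneg (sq_nonneg ε) (sq_nonneg |q|)]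
  have h1 := euclideanHausdorffMeasure_image_le_of_dist_le hbinj hdist
  have h2 : ENNReal.ofReal |LinearMap.det b| * volume s ≤
      ENNReal.ofReal (1 + ε) * ∫⁻ x in s, ENNReal.ofReal √(1 + ‖gradient g x‖ ^ 2) := by
    rw [hdet, abs_of_nonneg (Real.sqrt_nonneg _), ← setLIntegral_const,
      ← lintegral_const_mul _ (by fun_prop)]
    refine setLIntegral_mono' hsm fun x hx => ?_
    rw [← ENNReal.ofReal_mul (by positivity)]
    exact ENNReal.ofReal_le_ofReal (hs hx).2.le
  refine h1.trans ((mul_le_mul_right h2 _).trans_eq ?_)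
  change ENNReal.ofReal (1 + ε) ^ n * _ = _
  rw [← mul_assoc, ← pow_succ, ENNReal.ofReal_pow (by positivity)]

/-- The area of (a part of) the graph of a `C¹` function is at most the integral of the usual
density. -/
theorem euclideanHausdorffMeasure_image_graph_le {f : EuclideanSpace ℝ (Fin n) → Y}
    {g : EuclideanSpace ℝ (Fin n) → ℝ} (hg : ContDiff ℝ 1 g)
    (hf : ∀ x y, dist (f x) (f y) ^ 2 = dist x y ^ 2 + dist (g x) (g y) ^ 2)
    {s : Set (EuclideanSpace ℝ (Fin n))} (hs : MeasurableSet s) :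
    Measure.euclideanHausdorffMeasure n (f '' s) ≤
      ∫⁻ x in s, ENNReal.ofReal √(1 + ‖gradient g x‖ ^ 2) := by
  have key : ∀ ε : ℝ, 0 < ε → Measure.euclideanHausdorffMeasure n (f '' s) ≤
      ENNReal.ofReal ((1 + ε) ^ (n + 1)) *
        ∫⁻ x in s, ENNReal.ofReal √(1 + ‖gradient g x‖ ^ 2) := by
    intro ε hε
    choose W hW hWs using eventually_euclideanHausdorffMeasure_image_graph_le hg hf hε
    obtain ⟨t, ht, htW⟩ := TopologicalSpace.countable_cover_nhds
      (fun x => interior_mem_nhds.2 (hW x))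
    have hne : t.Nonempty := by
      by_contra h
      rw [Set.not_nonempty_iff_eq_empty] at h
      have : (0 : EuclideanSpace ℝ (Fin n)) ∈ ⋃ x ∈ t, interior (W x) := htW ▸ Set.mem_univ _
      simp [h] at this
    obtain ⟨e, he⟩ := ht.exists_eq_range hne
    -- The pieces of the countable cover are made disjoint so that the integrals over them add up
    -- without overcounting.
    set D := disjointed fun k => interior (W (e k)) with hD
    have hDm : ∀ k, MeasurableSet (D k) := fun k =>
      MeasurableSet.disjointed (fun k => isOpen_interior.measurableSet) k
    have hDU : ⋃ k, D k = Set.univ := by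
      rw [hD, iUnion_disjointed, ← htW, he, Set.biUnion_range]
    have hsU : s = ⋃ k, s ∩ D k := by rw [← Set.inter_iUnion, hDU, Set.inter_univ]
    have hsub : ∀ k, s ∩ D k ⊆ W (e k) := fun k =>
      Set.inter_subset_right.trans ((disjointed_subset _ k).trans interior_subset)
    conv_lhs => rw [hsU, Set.image_iUnion]
    refine (measure_iUnion_le _).trans ?_
    calc _ ≤ ∑' k, ENNReal.ofReal ((1 + ε) ^ (n + 1)) *
          ∫⁻ x in s ∩ D k, ENNReal.ofReal √(1 + ‖gradient g x‖ ^ 2) :=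
          ENNReal.tsum_le_tsum fun k => hWs _ _ (hsub k) (hs.inter (hDm k))
      _ = _ := by
          rw [ENNReal.tsum_mul_left, ← lintegral_iUnion (fun k => hs.inter (hDm k)), ← hsU]
          exact fun i j hij => ((disjoint_disjointed _ hij).mono Set.inter_subset_right
            Set.inter_subset_right)
  have hlim : Tendsto (fun ε : ℝ => ENNReal.ofReal ((1 + ε) ^ (n + 1)) *
      ∫⁻ x in s, ENNReal.ofReal √(1 + ‖gradient g x‖ ^ 2)) (𝓝[>] 0)
      (𝓝 (1 * ∫⁻ x in s, ENNReal.ofReal √(1 + ‖gradient g x‖ ^ 2))) := by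
    refine ENNReal.Tendsto.mul_const ?_ (Or.inl one_ne_zero)
    have : Continuous fun ε : ℝ => ENNReal.ofReal ((1 + ε) ^ (n + 1)) :=
      ENNReal.continuous_ofReal.comp (by fun_prop)
    simpa using (this.tendsto 0).mono_left nhdsWithin_le_nhds
  rw [one_mul] at hlim
  exact ge_of_tendsto hlim (eventually_nhdsWithin_of_forall key)

/-- An area bound for the parts of a graph bounds surface integrals over it. -/
theorem setLIntegral_range_le_of_image_le {f : EuclideanSpace ℝ (Fin n) → Y} (hf : Measurable f)
    {w : EuclideanSpace ℝ (Fin n) → ℝ≥0∞} (hw : Measurable w)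
    (h : ∀ s, MeasurableSet s → Measure.euclideanHausdorffMeasure n (f '' s) ≤ ∫⁻ x in s, w x)
    {φ : Y → ℝ≥0∞} (hφ : Measurable φ) :
    ∫⁻ y in Set.range f, φ y ∂(Measure.euclideanHausdorffMeasure n) ≤ ∫⁻ x, w x * φ (f x) := by
  -- The area bound for images of sets is a comparison of measures, which then integrates against
  -- any `φ`.
  have hle : (Measure.euclideanHausdorffMeasure n).restrict (Set.range f) ≤
      (volume.withDensity w).map f := by
    refine Measure.le_iff.2 fun B hB => ?_
    rw [Measure.restrict_apply hB, Measure.map_apply hf hB, withDensity_apply _ (hf hB),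
      ← Set.image_preimage_eq_inter_range]
    exact h _ (hf hB)
  refine (lintegral_mono' hle le_rfl).trans_eq ?_
  rw [lintegral_map hφ hf]
  exact lintegral_withDensity_eq_lintegral_mul _ hw (hφ.comp hf)

end SurfaceArea

/-! ### Straightening a subgraph by a shear. -/

section Subgraph

variable {n : ℕ}

/-- The shear of `ℝⁿ × ℝ` that maps the lower half space to the subgraph of `g`. -/
def graphShear {g : EuclideanSpace ℝ (Fin n) → ℝ} (hg : Continuous g) :
    EuclideanSpace ℝ (Fin n) × ℝ ≃ₜ WithLp 2 (EuclideanSpace ℝ (Fin n) × ℝ) where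
  toFun p := WithLp.toLp 2 (p.1, g p.1 + p.2)
  invFun z := (z.fst, z.snd - g z.fst)
  left_inv p := by simp
  right_inv z := by
    apply WithLp.ofLp_injective
    simp only [add_sub_cancel]
    rfl
  continuous_toFun := by fun_prop
  continuous_invFun := by fun_prop

theorem graphShear_apply {g : EuclideanSpace ℝ (Fin n) → ℝ} (hg : Continuous g)
    (p : EuclideanSpace ℝ (Fin n) × ℝ) :
    graphShear hg p = WithLp.toLp 2 (p.1, g p.1 + p.2) := rfl

theorem setLIntegral_subgraph_eq {g : EuclideanSpace ℝ (Fin n) → ℝ} (hg : Continuous g)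
    {k : WithLp 2 (EuclideanSpace ℝ (Fin n) × ℝ) → ℝ≥0∞} (hk : Measurable k) :
    ∫⁻ z in {z | z.snd < g z.fst}, k z =
      ∫⁻ p, k (graphShear hg p) ∂(volume.prod (volume.restrict (Set.Iio 0))) := by
  have hS : MeasurableSet {z : WithLp 2 (EuclideanSpace ℝ (Fin n) × ℝ) | z.snd < g z.fst} :=
    (isOpen_lt (by fun_prop) (by fun_prop)).measurableSet
  rw [← lintegral_indicator hS,
    ← (WithLp.volume_preserving_toLp (EuclideanSpace ℝ (Fin n)) ℝ).lintegral_comp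
      (hk.indicator hS), Measure.volume_eq_prod, lintegral_prod _ ?_, lintegral_prod _ ?_]
  · refine lintegral_congr fun x => ?_
    -- On each vertical line the shear is the translation by `g x`, so it preserves volume even when
    -- `g` is merely continuous.
    rw [← lintegral_add_left_eq_self _ (g x), ← lintegral_indicator measurableSet_Iio]
    refine lintegral_congr fun t => ?_
    simp only [Set.indicator_apply, Set.mem_ofPred_eq, Set.mem_Iio, graphShear_apply]
    simp
  · exact (hk.comp (graphShear hg).continuous.measurable).aemeasurable
  · exact ((hk.indicator hS).comp (WithLp.prod_continuous_toLp 2 _ _).measurable).aemeasurable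

theorem integral_fderiv_apply_eq_neg_integral_mul_div {k : EuclideanSpace ℝ (Fin n) → ℝ}
    (hk : ContDiff ℝ 1 k) (hkc : HasCompactSupport k)
    {b : EuclideanSpace ℝ (Fin n) → EuclideanSpace ℝ (Fin n)} (hb : ContDiff ℝ 1 b) :
    ∫ x, fderiv ℝ k x (b x) =
      -∫ x, k x * ∑ i, (fderiv ℝ b x (EuclideanSpace.single i 1)) i := by
  have hbi : ∀ i, ContDiff ℝ 1 fun x => b x i := fun i => by
    have := (EuclideanSpace.proj (𝕜 := ℝ) i).contDiff.comp hb (n := 1)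
    exact this
  have hfb : ∀ i x v, fderiv ℝ (fun x => b x i) x v = (fderiv ℝ b x v) i := by
    intro i x v
    have := ((EuclideanSpace.proj (𝕜 := ℝ) (ι := Fin n) i).hasFDerivAt.comp x
      (hb.differentiable one_ne_zero x).hasFDerivAt).fderiv
    exact congrArg (fun L => L v) this
  have hkd : ∀ v, Continuous fun x => fderiv ℝ k x v := fun v =>
    (hk.continuous_fderiv one_ne_zero).clm_apply continuous_const
  have hbd : ∀ i v, Continuous fun x => fderiv ℝ (fun x => b x i) x v := fun i v =>
    ((hbi i).continuous_fderiv one_ne_zero).clm_apply continuous_const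
  have hdc : ∀ v, HasCompactSupport fun x => fderiv ℝ k x v := fun v => hkc.fderiv_apply ℝ v
  have hi1 : ∀ i : Fin n, Integrable fun x =>
      fderiv ℝ k x (EuclideanSpace.single i 1) * b x i := fun i =>
    ((hkd _).mul (hbi i).continuous).integrable_of_hasCompactSupport (hdc _).mul_right
  have hi2 : ∀ i : Fin n, Integrable fun x =>
      k x * fderiv ℝ (fun x => b x i) x (EuclideanSpace.single i 1) := fun i =>
    (hk.continuous.mul (hbd i _)).integrable_of_hasCompactSupport hkc.mul_right
  have hsum : ∀ x, fderiv ℝ k x (b x) =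
      ∑ i, fderiv ℝ k x (EuclideanSpace.single i 1) * b x i := by
    intro x
    conv_lhs => rw [← (EuclideanSpace.basisFun (Fin n) ℝ).sum_repr (b x)]
    simp [map_sum, mul_comm]
  simp_rw [hsum, Finset.mul_sum, ← hfb]
  rw [integral_finsetSum _ fun i _ => hi1 i, integral_finsetSum _ fun i _ => hi2 i,
    ← Finset.sum_neg_distrib]
  refine Finset.sum_congr rfl fun i _ => ?_
  rw [integral_mul_fderiv_eq_neg_fderiv_mul_of_integrable (hi1 i) (hi2 i), neg_neg]
  · exact (hk.continuous.mul (hbi i).continuous).integrable_of_hasCompactSupport hkc.mul_right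
  · exact fun x _ => hk.differentiable one_ne_zero x
  · exact fun x _ => (hbi i).differentiable one_ne_zero x

theorem hasFDerivAt_comp_graphShear {g : EuclideanSpace ℝ (Fin n) → ℝ} (hg : Continuous g)
    {ψ : WithLp 2 (EuclideanSpace ℝ (Fin n) × ℝ) → ℝ} (hψ : Differentiable ℝ ψ)
    (p : EuclideanSpace ℝ (Fin n) × ℝ) (hgd : DifferentiableAt ℝ g p.1)
    (v : EuclideanSpace ℝ (Fin n) × ℝ) :
    fderiv ℝ (ψ ∘ graphShear hg) p v =
      fderiv ℝ ψ (graphShear hg p) (WithLp.toLp 2 (v.1, fderiv ℝ g p.1 v.1 + v.2)) := by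
  have h1 : HasFDerivAt (fun p : EuclideanSpace ℝ (Fin n) × ℝ => (p.1, g p.1 + p.2))
      ((ContinuousLinearMap.fst ℝ _ _).prod ((fderiv ℝ g p.1).comp (ContinuousLinearMap.fst ℝ _ _)
        + ContinuousLinearMap.snd ℝ _ _)) p :=
    hasFDerivAt_fst.prodMk ((hgd.hasFDerivAt.comp p hasFDerivAt_fst).add hasFDerivAt_snd)
  have h2 := ((WithLp.prodContinuousLinearEquiv 2 ℝ (EuclideanSpace ℝ (Fin n)) ℝ).symm.hasFDerivAt
    ).comp p h1
  have h3 := (hψ (graphShear hg p)).hasFDerivAt.comp p h2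
  exact congrArg (fun L => L v) h3.fderiv

end Subgraph

/-! ### `L¹` trace inequalities on a subgraph. -/

section SubgraphTrace

variable {n : ℕ}

theorem integral_Iio_fderiv_line {V : Type*} [NormedAddCommGroup V] [NormedSpace ℝ V] {ψ : V → ℝ}
    (hψ : ContDiff ℝ 1 ψ) (a e : V) (hc : HasCompactSupport fun t : ℝ => ψ (a + t • e)) :
    ∫ t in Set.Iio (0 : ℝ), fderiv ℝ ψ (a + t • e) e = ψ a := by
  have hd : ∀ t : ℝ, deriv (fun t : ℝ => ψ (a + t • e)) t = fderiv ℝ ψ (a + t • e) e := by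
    intro t
    have h1 : HasDerivAt (fun t : ℝ => a + t • e) e t := by
      simpa using ((hasDerivAt_id t).smul_const e).const_add a
    exact ((hψ.differentiable one_ne_zero _).hasFDerivAt.comp_hasDerivAt t h1).deriv
  simp_rw [← hd]
  have hk : ContDiff ℝ 1 fun t : ℝ => ψ (a + t • e) := hψ.comp (by fun_prop)
  rw [← integral_Iic_eq_integral_Iio, hc.integral_Iic_deriv_eq hk]
  simp

theorem integral_Iio_fderiv_graphShear {g : EuclideanSpace ℝ (Fin n) → ℝ} (hg : Continuous g)
    {ψ : WithLp 2 (EuclideanSpace ℝ (Fin n) × ℝ) → ℝ} (hψ : ContDiff ℝ 1 ψ)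
    (hψc : HasCompactSupport ψ) (x : EuclideanSpace ℝ (Fin n)) :
    ∫ t in Set.Iio (0 : ℝ), fderiv ℝ ψ (graphShear hg (x, t)) (WithLp.toLp 2 (0, 1)) =
      ψ (WithLp.toLp 2 (x, g x)) := by
  have hline : ∀ t : ℝ, graphShear hg (x, t) =
      WithLp.toLp 2 (x, g x) + t • WithLp.toLp 2 ((0 : EuclideanSpace ℝ (Fin n)), (1 : ℝ)) := by
    intro t
    rw [← WithLp.toLp_smul, ← WithLp.toLp_add, graphShear_apply]
    simp
  have hi : Isometry fun t : ℝ => (x, t) := Isometry.of_dist_eq fun s t => by simp [Prod.dist_eq]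
  have hc : HasCompactSupport fun t : ℝ => ψ (graphShear hg (x, t)) :=
    hψc.comp_isClosedEmbedding ((graphShear hg).isClosedEmbedding.comp hi.isClosedEmbedding)
  simp_rw [hline] at hc ⊢
  exact integral_Iio_fderiv_line hψ _ _ hc

/-- The boundary value is the integral of the vertical derivative along the line below it. This is
the divergence theorem for the vertical unit field and uses no differentiability of `g`. -/
theorem lintegral_graph_le {g : EuclideanSpace ℝ (Fin n) → ℝ} (hg : Continuous g)
    {ψ : WithLp 2 (EuclideanSpace ℝ (Fin n) × ℝ) → ℝ} (hψ : ContDiff ℝ 1 ψ)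
    (hψc : HasCompactSupport ψ) :
    ∫⁻ x, ENNReal.ofReal (ψ (WithLp.toLp 2 (x, g x))) ≤
      ∫⁻ z in {z | z.snd < g z.fst}, ‖fderiv ℝ ψ z‖ₑ := by
  have hc : Continuous fun z => ‖fderiv ℝ ψ z‖ₑ := (hψ.continuous_fderiv one_ne_zero).enorm
  have hm : AEMeasurable (fun p => ‖fderiv ℝ ψ (graphShear hg p)‖ₑ)
      ((volume : Measure (EuclideanSpace ℝ (Fin n))).prod (volume.restrict (Set.Iio (0 : ℝ)))) :=
    (hc.comp (graphShear hg).continuous).measurable.aemeasurable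
  rw [setLIntegral_subgraph_eq hg hc.measurable, lintegral_prod _ hm]
  refine lintegral_mono fun x => ?_
  rw [← integral_Iio_fderiv_graphShear hg hψ hψc x]
  refine (Real.ofReal_le_enorm _).trans ((enorm_integral_le_lintegral_enorm _).trans ?_)
  refine lintegral_mono fun t => ?_
  refine (ContinuousLinearMap.le_opENorm _ _).trans_eq ?_
  have : ‖WithLp.toLp 2 ((0 : EuclideanSpace ℝ (Fin n)), (1 : ℝ))‖ = 1 := by
    simp
  rw [← ofReal_norm (WithLp.toLp 2 _), this, ENNReal.ofReal_one, mul_one]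

theorem contDiff_gradient {E : Type*} [NormedAddCommGroup E] [InnerProductSpace ℝ E]
    [CompleteSpace E] {g : E → ℝ} (hg : ContDiff ℝ 2 g) : ContDiff ℝ 1 (gradient g) :=
  (InnerProductSpace.toDual ℝ E).symm.contDiff.comp
    (hg.fderiv_right (m := 1) (by norm_num [one_add_one_eq_two]))

/-- The divergence theorem on the subgraph of a `C²` function `g`, for the constant extension of the
unit normal to the graph. -/
theorem exists_integral_graph_area_le {g : EuclideanSpace ℝ (Fin n) → ℝ} (hg : ContDiff ℝ 2 g)
    {K : Set (EuclideanSpace ℝ (Fin n))} (hK : IsCompact K) :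
    ∃ C : ℝ, 0 ≤ C ∧ ∀ ψ : WithLp 2 (EuclideanSpace ℝ (Fin n) × ℝ) → ℝ, ContDiff ℝ 1 ψ →
      HasCompactSupport ψ → (∀ z, 0 ≤ ψ z) → (∀ z, z.fst ∉ K → ψ z = 0) →
      ∫ x, √(1 + ‖gradient g x‖ ^ 2) * ψ (WithLp.toLp 2 (x, g x)) ≤
        ∫ p, (C * ψ (graphShear hg.continuous p) + ‖fderiv ℝ ψ (graphShear hg.continuous p)‖)
          ∂(volume.prod (volume.restrict (Set.Iio 0))) := by
  have hgg : ContDiff ℝ 1 (gradient g) := contDiff_gradient hg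
  set w : EuclideanSpace ℝ (Fin n) → ℝ := fun x => √(1 + ‖gradient g x‖ ^ 2) with hw
  have hwpos : ∀ x, 0 < w x := fun x => Real.sqrt_pos.2 (by positivity)
  have hw2 : ∀ x, w x ^ 2 = 1 + ‖gradient g x‖ ^ 2 := fun x => Real.sq_sqrt (by positivity)
  have hwc : ContDiff ℝ 1 w := by
    refine ContDiff.sqrt ?_ fun x => by positivity
    exact contDiff_const.add (hgg.norm_sq ℝ)
  -- The unit normal is `(-b, w⁻¹)`, and its divergence is `-dv`. It is `C¹` because `g` is `C²`.
  set b : EuclideanSpace ℝ (Fin n) → EuclideanSpace ℝ (Fin n) := fun x => (w x)⁻¹ • gradient g x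
    with hb
  have hbc : ContDiff ℝ 1 b := (hwc.inv fun x => (hwpos x).ne').smul hgg
  set dv : EuclideanSpace ℝ (Fin n) → ℝ :=
    fun x => ∑ i, (fderiv ℝ b x (EuclideanSpace.single i 1)) i with hdv
  have hdvc : Continuous dv := by
    refine continuous_finsetSum _ fun i _ => ?_
    have := (hbc.continuous_fderiv one_ne_zero).clm_apply
      (continuous_const (y := EuclideanSpace.single i (1 : ℝ)))
    fun_prop
  obtain ⟨C, hC⟩ := hK.exists_bound_of_continuousOn hdvc.continuousOn
  refine ⟨max C 0, le_max_right _ _, fun ψ hψ hψc hψ0 hψK => ?_⟩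
  set S := graphShear hg.continuous with hS
  set μ : Measure (EuclideanSpace ℝ (Fin n) × ℝ) :=
    (volume : Measure (EuclideanSpace ℝ (Fin n))).prod (volume.restrict (Set.Iio (0 : ℝ))) with hμ
  have hcint : ∀ k : EuclideanSpace ℝ (Fin n) × ℝ → ℝ, Continuous k → HasCompactSupport k →
      Integrable k μ := fun k hk hkc => hk.integrable_of_hasCompactSupport hkc
  have hfc : Continuous (fderiv ℝ ψ) := hψ.continuous_fderiv one_ne_zero
  have hSc : Continuous S := S.continuous
  have hψS : HasCompactSupport (ψ ∘ S) := hψc.comp_homeomorph S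
  have hfS : HasCompactSupport (fderiv ℝ ψ ∘ S) := (hψc.fderiv ℝ).comp_homeomorph S
  have hSdiff : ContDiff ℝ 1 (ψ ∘ S) := by
    refine hψ.comp ?_
    have hg1 : ContDiff ℝ 1 g := hg.of_le (by norm_num)
    have : ContDiff ℝ 1 fun p : EuclideanSpace ℝ (Fin n) × ℝ => (p.1, g p.1 + p.2) := by fun_prop
    exact (WithLp.prodContinuousLinearEquiv 2 ℝ (EuclideanSpace ℝ (Fin n)) ℝ).symm.contDiff.comp
      this
  -- the vertical and the horizontal derivative
  set D₁ : EuclideanSpace ℝ (Fin n) × ℝ → ℝ :=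
    fun p => w p.1 * fderiv ℝ ψ (S p) (WithLp.toLp 2 (0, 1)) with hD₁
  set D₂ : EuclideanSpace ℝ (Fin n) × ℝ → ℝ := fun p => fderiv ℝ (ψ ∘ S) p (b p.1, 0) with hD₂
  have hD₁i : Integrable D₁ μ := by
    refine hcint _ ?_ ?_
    · exact (hwc.continuous.comp continuous_fst).mul
        ((hfc.comp hSc).clm_apply continuous_const)
    · refine HasCompactSupport.mul_left ?_
      exact hfS.comp_left (g := fun L => L (WithLp.toLp 2 (0, 1))) rfl
  have hD₂i : Integrable D₂ μ := by
    refine hcint _ ?_ ?_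
    · exact (hSdiff.continuous_fderiv one_ne_zero).clm_apply
        ((hbc.continuous.comp continuous_fst).prodMk continuous_const)
    · refine (hψS.fderiv ℝ).mono fun p hp => ?_
      contrapose! hp
      simp only [Function.mem_support, not_not] at hp ⊢
      simp [hD₂, hp]
  -- `D₂` differentiates along `(b, ∇g · b)`, tangent to the translated graphs. Since `w - w⁻¹ ‖∇g‖²
  -- = w⁻¹`, the difference `D₁ - D₂` is the derivative along the unit normal `(-b, w⁻¹)`; its
  -- length being one is the source of `M = 1`.
  have hle : ∀ p, D₁ p - D₂ p ≤ ‖fderiv ℝ ψ (S p)‖ := by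
    intro p
    rw [hD₁, hD₂]
    simp only
    rw [hasFDerivAt_comp_graphShear hg.continuous (hψ.differentiable one_ne_zero) p
      (hg.differentiable two_ne_zero _), ← smul_eq_mul, ← map_smul, ← map_sub]
    have hg2 : fderiv ℝ g p.1 (b p.1) = (w p.1)⁻¹ * ‖gradient g p.1‖ ^ 2 := by
      rw [hb, map_smul, smul_eq_mul, ← real_inner_self_eq_norm_sq, gradient,
        InnerProductSpace.toDual_symm_apply]
    have hn : ‖w p.1 • WithLp.toLp 2 ((0 : EuclideanSpace ℝ (Fin n)), (1 : ℝ)) -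
        WithLp.toLp 2 (b p.1, fderiv ℝ g p.1 (b p.1) + 0)‖ ≤ 1 := by
      refine abs_le_of_sq_le_sq' ?_ zero_le_one |>.2
      rw [← WithLp.toLp_smul, ← WithLp.toLp_sub, WithLp.prod_norm_sq_eq_of_L2, hg2]
      simp only [Prod.smul_mk, Prod.mk_sub_mk, smul_zero, zero_sub, smul_eq_mul, mul_one,
        add_zero, WithLp.toLp_fst, WithLp.toLp_snd, norm_neg, Real.norm_eq_abs, sq_abs, hb,
        norm_smul, mul_pow]
      have h1 := hw2 p.1
      have h2 : (w p.1)⁻¹ * w p.1 = 1 := inv_mul_cancel₀ (hwpos _).ne'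
      have h3 : ‖gradient g p.1‖ ^ 2 = w p.1 ^ 2 - 1 := by linarith
      have h4 : w p.1 - (w p.1)⁻¹ * (w p.1 ^ 2 - 1) = (w p.1)⁻¹ := by
        linear_combination -(w p.1) * h2
      rw [h3, h4]
      refine le_of_eq ?_
      linear_combination ((w p.1)⁻¹ * w p.1 + 1) * h2
    refine (Real.le_norm_self _).trans ((ContinuousLinearMap.le_opNorm _ _).trans ?_)
    exact mul_le_of_le_one_right (norm_nonneg _) hn
  have hI₁ : ∫ x, w x * ψ (WithLp.toLp 2 (x, g x)) = ∫ p, D₁ p ∂μ := by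
    rw [hμ, integral_prod _ hD₁i]
    refine integral_congr_ae (ae_of_all _ fun x => ?_)
    simp only [hD₁]
    rw [integral_const_mul, integral_Iio_fderiv_graphShear hg.continuous hψ hψc]
  -- For fixed `t` integration by parts in `x` runs over the whole of `ℝⁿ`, so no boundary term
  -- appears and only `dv`, bounded on `K`, remains.
  have hI₂ : ∫ p, D₂ p ∂μ ≤ ∫ p, max C 0 * ψ (S p) ∂μ := by
    have hi : Integrable (fun p => ψ (S p) * dv p.1) μ :=
      hcint _ (by have := hψ.continuous; fun_prop) (HasCompactSupport.mul_right hψS)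
    have : ∫ p, D₂ p ∂μ = -∫ p, ψ (S p) * dv p.1 ∂μ := by
      rw [hμ, integral_prod_symm _ hD₂i, integral_prod_symm _ hi, ← integral_neg]
      refine integral_congr_ae (ae_of_all _ fun t => ?_)
      have hi : Isometry fun x : EuclideanSpace ℝ (Fin n) => (x, t) :=
        Isometry.of_dist_eq fun s t => by simp [Prod.dist_eq]
      have hkc : HasCompactSupport fun x => (ψ ∘ S) (x, t) :=
        hψS.comp_isClosedEmbedding hi.isClosedEmbedding
      have hk : ContDiff ℝ 1 fun x => (ψ ∘ S) (x, t) := hSdiff.comp (by fun_prop)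
      refine Eq.trans ?_ (integral_fderiv_apply_eq_neg_integral_mul_div hk hkc hbc)
      refine integral_congr_ae (ae_of_all _ fun x => ?_)
      have h1 : HasFDerivAt (fun x : EuclideanSpace ℝ (Fin n) => (x, t))
          ((ContinuousLinearMap.id ℝ _).prod 0) x :=
        (hasFDerivAt_id x).prodMk (hasFDerivAt_const t x)
      have h2 := ((hSdiff.differentiable one_ne_zero (x, t)).hasFDerivAt.comp x h1).fderiv
      exact (congrArg (fun L => L (b x)) h2).symm
    rw [this, ← integral_neg]
    refine integral_mono hi.neg ((hcint _ (by have := hψ.continuous; fun_prop) hψS).const_mul _)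
      fun p => ?_
    by_cases hp : p.1 ∈ K
    · have h1 := hC _ hp
      rw [Real.norm_eq_abs] at h1
      have h2 : -dv p.1 ≤ max C 0 := (neg_le_abs _).trans (h1.trans (le_max_left _ _))
      have := mul_le_mul_of_nonneg_left h2 (hψ0 (S p))
      simp only
      linarith
    · simp [hψK (S p) (by simpa [hS, graphShear_apply] using hp)]
  have hi3 : Integrable (fun p => ‖fderiv ℝ ψ (S p)‖) μ :=
    hcint _ (hfc.comp hSc).norm hfS.norm
  have hi4 : Integrable (fun p => max C 0 * ψ (S p)) μ :=
    (hcint _ (by have := hψ.continuous; fun_prop) hψS).const_mul _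
  rw [integral_add hi4 hi3, hI₁]
  have h5 := integral_mono (hD₁i.sub hD₂i) hi3 hle
  simp only [Pi.sub_apply] at h5
  rw [integral_sub hD₁i hD₂i] at h5
  linarith

theorem exists_lintegral_graph_area_le {g : EuclideanSpace ℝ (Fin n) → ℝ} (hg : ContDiff ℝ 2 g)
    {K : Set (EuclideanSpace ℝ (Fin n))} (hK : IsCompact K) :
    ∃ C : ℝ≥0, ∀ ψ : WithLp 2 (EuclideanSpace ℝ (Fin n) × ℝ) → ℝ, ContDiff ℝ 1 ψ →
      HasCompactSupport ψ → (∀ z, 0 ≤ ψ z) → (∀ z, z.fst ∉ K → ψ z = 0) →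
      ∫⁻ x, ENNReal.ofReal √(1 + ‖gradient g x‖ ^ 2) *
          ENNReal.ofReal (ψ (WithLp.toLp 2 (x, g x))) ≤
        ∫⁻ z in {z | z.snd < g z.fst}, (C * ENNReal.ofReal (ψ z) + ‖fderiv ℝ ψ z‖ₑ) := by
  obtain ⟨C, hC0, hC⟩ := exists_integral_graph_area_le hg hK
  refine ⟨C.toNNReal, fun ψ hψ hψc hψ0 hψK => ?_⟩
  have hfc : Continuous (fderiv ℝ ψ) := hψ.continuous_fderiv one_ne_zero
  have hψm : Continuous ψ := hψ.continuous
  rw [setLIntegral_subgraph_eq hg.continuous (by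
    refine Measurable.add ?_ hfc.enorm.measurable
    exact (ENNReal.continuous_ofReal.comp hψm).measurable.const_mul _)]
  have h := ENNReal.ofReal_le_ofReal (hC ψ hψ hψc hψ0 hψK)
  have hSc := (graphShear hg.continuous).continuous
  have hi1 : Integrable (fun x => √(1 + ‖gradient g x‖ ^ 2) * ψ (WithLp.toLp 2 (x, g x))) := by
    have hemb : IsClosedEmbedding fun x : EuclideanSpace ℝ (Fin n) =>
        graphShear hg.continuous (x, 0) := by
      have hi : Isometry fun x : EuclideanSpace ℝ (Fin n) => (x, (0 : ℝ)) :=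
        Isometry.of_dist_eq fun s t => by simp [Prod.dist_eq]
      exact (graphShear hg.continuous).isClosedEmbedding.comp hi.isClosedEmbedding
    have h1 : HasCompactSupport fun x => ψ (WithLp.toLp 2 (x, g x)) := by
      simpa [graphShear_apply, Function.comp_def] using hψc.comp_isClosedEmbedding hemb
    refine Continuous.integrable_of_hasCompactSupport ?_ h1.mul_left
    have := (contDiff_gradient hg).continuous
    have := hg.continuous
    fun_prop
  have hi2 : Integrable (fun p => C * ψ (graphShear hg.continuous p) +
      ‖fderiv ℝ ψ (graphShear hg.continuous p)‖)
      ((volume : Measure (EuclideanSpace ℝ (Fin n))).prod (volume.restrict (Set.Iio (0 : ℝ)))) := by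
    refine Integrable.add (Integrable.const_mul ?_ _) ?_
    · exact (hψm.comp hSc).integrable_of_hasCompactSupport (hψc.comp_homeomorph _)
    · exact (hfc.comp hSc).norm.integrable_of_hasCompactSupport
        ((hψc.fderiv ℝ).comp_homeomorph (graphShear hg.continuous)).norm
  rw [ofReal_integral_eq_lintegral_ofReal hi1 (ae_of_all _ fun x =>
      mul_nonneg (Real.sqrt_nonneg _) (hψ0 _)),
    ofReal_integral_eq_lintegral_ofReal hi2 (ae_of_all _ fun p =>
      add_nonneg (mul_nonneg hC0 (hψ0 _)) (norm_nonneg _))] at h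
  convert h using 3 with x p
  · rw [ENNReal.ofReal_mul (Real.sqrt_nonneg _)]
  · rw [ENNReal.ofReal_add (mul_nonneg hC0 (hψ0 _)) (norm_nonneg _), ENNReal.ofReal_mul hC0,
      ofReal_norm]
    rfl

end SubgraphTrace

/-! ### Local trace inequalities in boundary charts. -/

section Charts

variable {d : ℕ} {Ω U : Set (EuclideanSpace ℝ (Fin d))}

/-- The `L¹` trace inequality on `Ω` for functions supported in `U`. -/
def LocalTraceBound (Ω U : Set (EuclideanSpace ℝ (Fin d))) (C M : ℝ≥0) : Prop :=
  ∀ ψ : EuclideanSpace ℝ (Fin d) → ℝ, ContDiff ℝ 1 ψ → HasCompactSupport ψ → (∀ x, 0 ≤ ψ x) →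
    tsupport ψ ⊆ U → ∫⁻ y, ENNReal.ofReal (ψ y) ∂(surfaceMeasure Ω) ≤
      ∫⁻ x in Ω, (C * ENNReal.ofReal (ψ x) + M * ‖fderiv ℝ ψ x‖ₑ)

theorem LocalTraceBound.mono {V : Set (EuclideanSpace ℝ (Fin d))} {C C' M M' : ℝ≥0}
    (h : LocalTraceBound Ω U C M) (hV : V ⊆ U) (hC : C ≤ C') (hM : M ≤ M') :
    LocalTraceBound Ω V C' M' := fun ψ hψ hψc hψ0 hψV =>
  (h ψ hψ hψc hψ0 (hψV.trans hV)).trans <| lintegral_mono fun x => by gcongr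

theorem eq_graph_of_mem_frontier (hΩ : IsOpen Ω)
    {T : EuclideanSpace ℝ (Fin d) ≃ₗᵢ[ℝ] WithLp 2 (EuclideanSpace ℝ (Fin (d - 1)) × ℝ)}
    {g : EuclideanSpace ℝ (Fin (d - 1)) → ℝ} (hg : Continuous g) (hU : IsOpen U)
    (h : ∀ x ∈ U, x ∈ Ω ↔ (T x).snd < g (T x).fst) {x : EuclideanSpace ℝ (Fin d)} (hxU : x ∈ U)
    (hx : x ∈ frontier Ω) : (T x).snd = g (T x).fst := by
  rw [hΩ.frontier_eq] at hx
  have hT : Continuous T := T.continuous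
  refine le_antisymm ?_ (not_lt.1 fun hlt => hx.2 ((h x hxU).2 hlt))
  by_contra! hlt
  have ho : IsOpen {y | g (T y).fst < (T y).snd} := isOpen_lt (by fun_prop) (by fun_prop)
  obtain ⟨y, ⟨hyU, hy⟩, hyΩ⟩ := mem_closure_iff.1 hx.1 _ (hU.inter ho) ⟨hxU, hlt⟩
  exact lt_asymm hy ((h y hyU).1 hyΩ)

/-- Inside `U` the boundary lies on the graph and `Ω` is the subgraph; outside `U` both `ψ` and its
derivative vanish. The isometry `T` then carries the flat inequality `hflat`, with area density `w`,
over to `Ω`. -/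
theorem localTraceBound_of_chart (hΩ : IsOpen Ω)
    {T : EuclideanSpace ℝ (Fin d) ≃ₗᵢ[ℝ] WithLp 2 (EuclideanSpace ℝ (Fin (d - 1)) × ℝ)}
    {g : EuclideanSpace ℝ (Fin (d - 1)) → ℝ} (hg : Continuous g) (hU : IsOpen U)
    (h : ∀ x ∈ U, x ∈ Ω ↔ (T x).snd < g (T x).fst)
    {w : EuclideanSpace ℝ (Fin (d - 1)) → ℝ≥0∞} (hw : Measurable w)
    (harea : ∀ s, MeasurableSet s → Measure.euclideanHausdorffMeasure (d - 1)
      ((fun x => T.symm (WithLp.toLp 2 (x, g x))) '' s) ≤ ∫⁻ x in s, w x) {C M : ℝ≥0}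
    (hflat : ∀ ψ : WithLp 2 (EuclideanSpace ℝ (Fin (d - 1)) × ℝ) → ℝ, ContDiff ℝ 1 ψ →
      HasCompactSupport ψ → (∀ z, 0 ≤ ψ z) → (∀ z, T.symm z ∉ U → ψ z = 0) →
      ∫⁻ x, w x * ENNReal.ofReal (ψ (WithLp.toLp 2 (x, g x))) ≤
        ∫⁻ z in {z | z.snd < g z.fst}, (C * ENNReal.ofReal (ψ z) + M * ‖fderiv ℝ ψ z‖ₑ)) :
    LocalTraceBound Ω U C M := by
  intro ψ hψ hψc hψ0 hψU
  have hψz : ∀ x, x ∉ U → ψ x = 0 := fun x hx => image_eq_zero_of_notMem_tsupport fun hx' =>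
    hx (hψU hx')
  have hfψz : ∀ x, x ∉ U → fderiv ℝ ψ x = 0 := fun x hx =>
    image_eq_zero_of_notMem_tsupport fun hx' => hx (hψU (tsupport_fderiv_subset ℝ hx'))
  have hT : Continuous T := T.continuous
  have hTs : Continuous T.symm := T.symm.continuous
  have hfm : Measurable fun x => T.symm (WithLp.toLp 2 (x, g x)) := by
    have : Continuous fun x => T.symm (WithLp.toLp 2 (x, g x)) := by fun_prop
    exact this.measurable
  have hS : MeasurableSet
      {z : WithLp 2 (EuclideanSpace ℝ (Fin (d - 1)) × ℝ) | z.snd < g z.fst} :=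
    (isOpen_lt (by fun_prop) (by fun_prop)).measurableSet
  have hψT : ContDiff ℝ 1 (ψ ∘ T.symm) := hψ.comp T.symm.contDiff
  calc ∫⁻ y, ENNReal.ofReal (ψ y) ∂(surfaceMeasure Ω)
      ≤ ∫⁻ y in Set.range (fun x => T.symm (WithLp.toLp 2 (x, g x))), ENNReal.ofReal (ψ y)
          ∂(Measure.euclideanHausdorffMeasure (d - 1)) := by
        rw [surfaceMeasure, ← lintegral_indicator isClosed_frontier.measurableSet]
        refine le_trans (lintegral_mono fun y => ?_) (lintegral_indicator_le _ _)
        by_cases hy : y ∈ frontier Ω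
        · by_cases hyU : y ∈ U
          · have hmem : y ∈ Set.range (fun x => T.symm (WithLp.toLp 2 (x, g x))) := by
              refine ⟨(T y).fst, ?_⟩
              beta_reduce
              rw [← eq_graph_of_mem_frontier hΩ hg hU h hyU hy]
              exact T.symm_apply_apply y
            simp only [Set.indicator_of_mem hy, Set.indicator_of_mem hmem, le_refl]
          · simp [Set.indicator_of_mem hy, hψz y hyU]
        · simp [Set.indicator_of_notMem hy]
    _ ≤ ∫⁻ x, w x * ENNReal.ofReal ((ψ ∘ T.symm) (WithLp.toLp 2 (x, g x))) :=
        setLIntegral_range_le_of_image_le hfm hw harea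
          (ENNReal.continuous_ofReal.comp hψ.continuous).measurable
    _ ≤ ∫⁻ z in {z | z.snd < g z.fst},
          (C * ENNReal.ofReal ((ψ ∘ T.symm) z) + M * ‖fderiv ℝ (ψ ∘ T.symm) z‖ₑ) :=
        hflat _ hψT (hψc.comp_homeomorph T.symm.toHomeomorph) (fun z => hψ0 _)
          fun z hz => hψz _ hz
    _ = ∫⁻ x in T ⁻¹' {z | z.snd < g z.fst},
          (C * ENNReal.ofReal (ψ x) + M * ‖fderiv ℝ ψ x‖ₑ) := by
        rw [← T.measurePreserving.setLIntegral_comp_preimage hS]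
        · refine lintegral_congr fun x => ?_
          have hfd : ‖fderiv ℝ (ψ ∘ T.symm) (T x)‖ = ‖fderiv ℝ ψ x‖ := by
            have := T.symm.toContinuousLinearEquiv.comp_right_fderiv (f := ψ) (x := T x)
            refine (congrArg norm this).trans ?_
            refine (ContinuousLinearMap.opNorm_comp_linearIsometryEquiv _ T.symm).trans ?_
            exact congrArg (fun y => ‖fderiv ℝ ψ y‖) (T.symm_apply_apply x)
          rw [← ofReal_norm, hfd, ofReal_norm, Function.comp_apply, T.symm_apply_apply]
        · have h1 := (ENNReal.continuous_ofReal.comp hψT.continuous).measurable.const_mul (C : ℝ≥0∞)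
          have h2 := (hψT.continuous_fderiv one_ne_zero).enorm.measurable.const_mul (M : ℝ≥0∞)
          exact h1.add h2
    _ ≤ _ := by
        rw [← lintegral_indicator (T.continuous.measurable hS)]
        refine le_trans (lintegral_mono fun x => ?_) (lintegral_indicator_le _ _)
        by_cases hxU : x ∈ U
        · have hiff : x ∈ T ⁻¹' {z | z.snd < g z.fst} ↔ x ∈ Ω := (h x hxU).symm
          by_cases hx : x ∈ Ω
          · rw [Set.indicator_of_mem hx, Set.indicator_of_mem (hiff.2 hx)]
          · rw [Set.indicator_of_notMem hx, Set.indicator_of_notMem (mt hiff.1 hx)]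
        · refine (Set.indicator_le_self _ _ _).trans ?_
          have h0 : ‖fderiv ℝ ψ x‖ₑ = 0 := by
            rw [← ofReal_norm, hfψz x hxU, norm_zero, ENNReal.ofReal_zero]
          simp [hψz x hxU, h0]

theorem dist_graph_sq (T : EuclideanSpace ℝ (Fin d) ≃ₗᵢ[ℝ]
      WithLp 2 (EuclideanSpace ℝ (Fin (d - 1)) × ℝ)) (g : EuclideanSpace ℝ (Fin (d - 1)) → ℝ)
    (x y : EuclideanSpace ℝ (Fin (d - 1))) :
    dist (T.symm (WithLp.toLp 2 (x, g x))) (T.symm (WithLp.toLp 2 (y, g y))) ^ 2 =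
      dist x y ^ 2 + dist (g x) (g y) ^ 2 := by
  rw [T.symm.dist_map, WithLp.prod_dist_eq_of_L2, Real.sq_sqrt (by positivity)]
  rfl

theorem exists_localTraceBound_of_lipschitz (hΩ : IsOpen Ω)
    (h : HasGraphBoundary (fun g => ∃ K, LipschitzWith K g) Ω) {z : EuclideanSpace ℝ (Fin d)}
    (hz : z ∈ frontier Ω) : ∃ U, IsOpen U ∧ z ∈ U ∧ ∃ C M, LocalTraceBound Ω U C M := by
  obtain ⟨T, U, g, hU, hzU, ⟨K, hK⟩, hg⟩ := h z hz
  refine ⟨U, hU, hzU, 0, (1 + K) ^ (d - 1), localTraceBound_of_chart hΩ hK.continuous hU hg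
    (w := fun _ => ((1 + K : ℝ≥0) : ℝ≥0∞) ^ (d - 1)) measurable_const (fun s hs => ?_)
    fun ψ hψ hψc _ _ => ?_⟩
  · rw [setLIntegral_const]
    exact euclideanHausdorffMeasure_image_graph_le_of_lipschitz hK (dist_graph_sq T g) s
  · have hm : Measurable fun x => ENNReal.ofReal (ψ (WithLp.toLp 2 (x, g x))) := by
      have := hK.continuous
      have := hψ.continuous
      exact (ENNReal.continuous_ofReal.comp (by fun_prop)).measurable
    rw [lintegral_const_mul _ hm]
    simp only [ENNReal.coe_zero, zero_mul, zero_add, ENNReal.coe_pow]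
    rw [lintegral_const_mul _ (hψ.continuous_fderiv one_ne_zero).enorm.measurable]
    exact mul_le_mul_right (lintegral_graph_le hK.continuous hψ hψc) _

theorem exists_localTraceBound_of_C2 (hΩ : IsOpen Ω) (h : HasC2Boundary Ω)
    {z : EuclideanSpace ℝ (Fin d)} (hz : z ∈ frontier Ω) :
    ∃ U, IsOpen U ∧ z ∈ U ∧ ∃ C, LocalTraceBound Ω U C 1 := by
  obtain ⟨T, U, g, hU, hzU, hgc, hg⟩ := h z hz
  -- The chart is shrunk to a unit ball because the divergence of the normal field is bounded only
  -- over compact sets.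
  have hK : IsCompact ((fun x => (T x).fst) '' Metric.closedBall z 1) := by
    have := T.continuous
    exact (isCompact_closedBall z 1).image (by fun_prop)
  obtain ⟨C, hC⟩ := exists_lintegral_graph_area_le hgc hK
  have hgc1 : ContDiff ℝ 1 g := hgc.of_le (by norm_num)
  have hgg := (contDiff_gradient hgc).continuous
  refine ⟨U ∩ Metric.ball z 1, hU.inter Metric.isOpen_ball, ⟨hzU, Metric.mem_ball_self one_pos⟩, C,
    localTraceBound_of_chart hΩ hgc.continuous (hU.inter Metric.isOpen_ball)
      (fun x hx => hg x hx.1) (w := fun x => ENNReal.ofReal √(1 + ‖gradient g x‖ ^ 2))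
      (ENNReal.continuous_ofReal.comp (by fun_prop)).measurable
      (fun s hs => euclideanHausdorffMeasure_image_graph_le hgc1 (dist_graph_sq T g) hs)
      fun ψ hψ hψc hψ0 hψU => ?_⟩
  simp only [ENNReal.coe_one, one_mul]
  refine hC ψ hψ hψc hψ0 fun y hy => hψU y fun hyU => hy ⟨T.symm y, ?_, ?_⟩
  · exact Metric.ball_subset_closedBall hyU.2
  · simp

end Charts

/-! ### The global trace inequality, its passage to `H¹`, and the eigenvalue bound. -/

section Trace

variable {d : ℕ} {Ω : Set (EuclideanSpace ℝ (Fin d))}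

theorem norm_fderiv_norm_sq_le {φ : EuclideanSpace ℝ (Fin d) → ℂ}
    {x : EuclideanSpace ℝ (Fin d)} (hφ : DifferentiableAt ℝ φ x) :
    ‖fderiv ℝ (fun y => ‖φ y‖ ^ 2) x‖ ≤ 2 * ‖φ x‖ * √(∑ i, ‖partialDeriv i φ x‖ ^ 2) := by
  refine ContinuousLinearMap.opNorm_le_bound _ (by positivity) fun v => ?_
  have h1 : fderiv ℝ (fun y => ‖φ y‖ ^ 2) x v = 2 * ⟪φ x, fderiv ℝ φ x v⟫_ℝ := by
    rw [hφ.hasFDerivAt.norm_sq.fderiv]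
    simp
    ring
  have h2 : ‖fderiv ℝ φ x v‖ ≤ √(∑ i, ‖partialDeriv i φ x‖ ^ 2) * ‖v‖ := by
    have h3 : fderiv ℝ φ x v = ∑ i, v i • partialDeriv i φ x := by
      conv_lhs => rw [← (EuclideanSpace.basisFun (Fin d) ℝ).sum_repr v]
      simp [map_sum, partialDeriv]
    rw [h3, EuclideanSpace.norm_eq, mul_comm]
    refine (norm_sum_le _ _).trans ?_
    simp_rw [norm_smul]
    exact Real.sum_mul_le_sqrt_mul_sqrt _ _ _
  rw [h1, norm_mul, Real.norm_ofNat, mul_assoc, mul_assoc]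
  gcongr
  refine (norm_inner_le_norm _ _).trans ?_
  gcongr

/-- Local trace inequalities around the points of a compact boundary give a global one. -/
theorem exists_trace_inequality (hb : Bornology.IsBounded Ω) {Q : Set ℝ≥0} (hQ0 : 0 ∈ Q)
    (hQ : ∀ a ∈ Q, ∀ b ∈ Q, a ⊔ b ∈ Q)
    (h : ∀ z ∈ frontier Ω, ∃ U, IsOpen U ∧ z ∈ U ∧ ∃ C, ∃ M ∈ Q, LocalTraceBound Ω U C M) :
    ∃ C : ℝ, 0 ≤ C ∧ ∃ M ∈ Q, ∀ φ : EuclideanSpace ℝ (Fin d) → ℂ, ContDiff ℝ ∞ φ →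
      ∫⁻ y, ENNReal.ofReal (‖φ y‖ ^ 2) ∂(surfaceMeasure Ω) ≤ ∫⁻ x in Ω, ENNReal.ofReal
        (C * ‖φ x‖ ^ 2 + 2 * M * ‖φ x‖ * √(∑ i, ‖partialDeriv i φ x‖ ^ 2)) := by
  have hcomp : IsCompact (frontier Ω) := Metric.isCompact_of_isClosed_isBounded isClosed_frontier
    (hb.closure.subset frontier_subset_closure)
  choose! U hUo hzU C M hMQ hloc using h
  obtain ⟨t, htf, htU⟩ := hcomp.elim_nhds_subcover (fun z => U z ∩ Metric.ball z 1) fun z hz =>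
    ((hUo z hz).inter Metric.isOpen_ball).mem_nhds ⟨hzU z hz, Metric.mem_ball_self one_pos⟩
  set C₀ := t.sup C
  set M₀ := t.sup M
  -- Taking a maximum, not a sum, of the local constants keeps `M₀` in `Q`; with `Q = Set.Iic 1`
  -- this preserves the bound `M ≤ 1`.
  have hM₀ : M₀ ∈ Q := Finset.sup_mem Q hQ0 hQ t M fun z hz => hMQ z (htf z hz)
  have hloc₀ : ∀ z : t, LocalTraceBound Ω (U z ∩ Metric.ball (z : _) 1) C₀ M₀ := fun z =>
    (hloc z (htf z z.2)).mono Set.inter_subset_left (Finset.le_sup z.2) (Finset.le_sup z.2)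
  obtain ⟨f, hf⟩ := SmoothPartitionOfUnity.exists_isSubordinate
    (modelWithCornersSelf ℝ (EuclideanSpace ℝ (Fin d))) (isClosed_frontier (s := Ω))
    (fun z : t => U z ∩ Metric.ball (z : EuclideanSpace ℝ (Fin d)) 1)
    (fun z => (hUo z (htf z z.2)).inter Metric.isOpen_ball)
    (by rwa [Set.iUnion_subtype])
  have hfc : ∀ z, ContDiff ℝ 1 (f z) := fun z =>
    ((f z).contMDiff.contDiff).of_le (by exact_mod_cast le_top)
  have hfs : ∀ z, HasCompactSupport (f z) := fun z =>
    Metric.isCompact_of_isClosed_isBounded (isClosed_tsupport _)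
      (Metric.isBounded_ball.subset ((hf z).trans Set.inter_subset_right))
  have hL : ∀ z, ∃ L, ∀ x, ‖fderiv ℝ (f z) x‖ ≤ L := fun z =>
    ((hfs z).fderiv ℝ).exists_bound_of_continuous ((hfc z).continuous_fderiv one_ne_zero)
  choose L hL using hL
  have hL0 : ∀ z, 0 ≤ L z := fun z => (norm_nonneg _).trans (hL z 0)
  refine ⟨C₀ + M₀ * ∑ z, L z, add_nonneg C₀.2 (mul_nonneg M₀.2 (Finset.sum_nonneg fun z _ => hL0 z)),
    M₀, hM₀, fun φ hφ => ?_⟩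
  have hφ1 : ContDiff ℝ 1 φ := hφ.of_le (by exact_mod_cast le_top)
  have hφd : Differentiable ℝ φ := hφ1.differentiable one_ne_zero
  have hn : ContDiff ℝ 1 fun x => ‖φ x‖ ^ 2 := hφ1.norm_sq ℝ
  set G : EuclideanSpace ℝ (Fin d) → ℝ := fun x => √(∑ i, ‖partialDeriv i φ x‖ ^ 2) with hG
  have hψc : ∀ z, ContDiff ℝ 1 fun x => f z x * ‖φ x‖ ^ 2 := fun z => (hfc z).mul hn
  have hfd : ∀ z x, ‖fderiv ℝ (fun x => f z x * ‖φ x‖ ^ 2) x‖ ≤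
      L z * ‖φ x‖ ^ 2 + f z x * (2 * ‖φ x‖ * G x) := by
    intro z x
    rw [fderiv_fun_mul ((hfc z).differentiable one_ne_zero x) (hn.differentiable one_ne_zero x)]
    refine (norm_add_le _ _).trans ?_
    rw [norm_smul, norm_smul, add_comm, Real.norm_of_nonneg (f.nonneg z x), norm_pow, norm_norm,
      mul_comm (L z)]
    have h1 := norm_fderiv_norm_sq_le (hφd x)
    have h2 := hL z x
    have h3 := f.nonneg z x
    gcongr
  have hsum : ∀ x, ∑ᶠ z, f z x = ∑ z, f z x := fun x => finsum_eq_sum_of_fintype _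
  calc ∫⁻ y, ENNReal.ofReal (‖φ y‖ ^ 2) ∂(surfaceMeasure Ω)
      = ∫⁻ y, ∑ z, ENNReal.ofReal (f z y * ‖φ y‖ ^ 2) ∂(surfaceMeasure Ω) := by
        refine setLIntegral_congr_fun isClosed_frontier.measurableSet fun y hy => ?_
        rw [← ENNReal.ofReal_sum_of_nonneg fun z _ => mul_nonneg (f.nonneg z y) (by positivity),
          ← Finset.sum_mul, ← hsum, f.sum_eq_one hy, one_mul]
    _ = ∑ z, ∫⁻ y, ENNReal.ofReal (f z y * ‖φ y‖ ^ 2) ∂(surfaceMeasure Ω) :=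
        lintegral_finsetSum _ fun z _ =>
          (ENNReal.continuous_ofReal.comp (hψc z).continuous).measurable
    _ ≤ ∑ z, ∫⁻ x in Ω, (C₀ * ENNReal.ofReal (f z x * ‖φ x‖ ^ 2) +
          M₀ * ‖fderiv ℝ (fun x => f z x * ‖φ x‖ ^ 2) x‖ₑ) :=
        Finset.sum_le_sum fun z _ => hloc₀ z _ (hψc z) (hfs z).mul_right
          (fun x => mul_nonneg (f.nonneg z x) (by positivity))
          ((tsupport_mul_subset_left).trans (hf z))
    _ = ∫⁻ x in Ω, ∑ z, (C₀ * ENNReal.ofReal (f z x * ‖φ x‖ ^ 2) +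
          M₀ * ‖fderiv ℝ (fun x => f z x * ‖φ x‖ ^ 2) x‖ₑ) := by
        refine (lintegral_finsetSum _ fun z _ => Measurable.add ?_ ?_).symm
        · exact (ENNReal.continuous_ofReal.comp (hψc z).continuous).measurable.const_mul _
        · exact ((hψc z).continuous_fderiv one_ne_zero).enorm.measurable.const_mul _
    _ ≤ _ := by
        refine lintegral_mono fun x => ?_
        have hG0 : 0 ≤ G x := Real.sqrt_nonneg _
        have hterm : ∀ z, C₀ * ENNReal.ofReal (f z x * ‖φ x‖ ^ 2) +
            M₀ * ‖fderiv ℝ (fun x => f z x * ‖φ x‖ ^ 2) x‖ₑ ≤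
            ENNReal.ofReal (C₀ * (f z x * ‖φ x‖ ^ 2) +
              M₀ * (L z * ‖φ x‖ ^ 2 + f z x * (2 * ‖φ x‖ * G x))) := by
          intro z
          have h3 := f.nonneg z x
          have h4 := hL0 z
          rw [ENNReal.ofReal_add (by positivity) (by positivity), ENNReal.ofReal_mul C₀.coe_nonneg,
            ENNReal.ofReal_mul M₀.coe_nonneg, ENNReal.ofReal_coe_nnreal, ENNReal.ofReal_coe_nnreal,
            ← ofReal_norm]
          gcongr
          exact hfd z x
        refine (Finset.sum_le_sum fun z _ => hterm z).trans ?_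
        rw [← ENNReal.ofReal_sum_of_nonneg fun z _ => by
          have h3 := f.nonneg z x
          have h4 := hL0 z
          positivity]
        refine ENNReal.ofReal_le_ofReal ?_
        -- The cutoffs sum to one only on the boundary, but at most one everywhere, so the
        -- coefficient `2 * M₀` of the gradient term is not enlarged.
        have hle : ∑ z, f z x ≤ 1 := hsum x ▸ f.sum_le_one x
        have heq : ∑ z, (C₀ * (f z x * ‖φ x‖ ^ 2) +
              M₀ * (L z * ‖φ x‖ ^ 2 + f z x * (2 * ‖φ x‖ * G x))) =
            (∑ z, f z x) * (C₀ * ‖φ x‖ ^ 2 + 2 * M₀ * ‖φ x‖ * G x) +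
              M₀ * (∑ z, L z) * ‖φ x‖ ^ 2 := by
          simp only [Finset.sum_mul, Finset.mul_sum, ← Finset.sum_add_distrib]
          exact Finset.sum_congr rfl fun z _ => by ring
        rw [heq]
        have := mul_le_mul_of_nonneg_right hle
          (show 0 ≤ C₀ * ‖φ x‖ ^ 2 + 2 * M₀ * ‖φ x‖ * G x by positivity)
        linarith

theorem eLpNorm_two_sq {X F : Type*} [MeasurableSpace X] [NormedAddCommGroup F] (μ : Measure X)
    (f : X → F) : eLpNorm f 2 μ ^ 2 = ∫⁻ x, ENNReal.ofReal (‖f x‖ ^ 2) ∂μ := by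
  have h := eLpNorm_nnreal_pow_eq_lintegral (f := f) (μ := μ) (p := 2) two_ne_zero
  simp only [NNReal.coe_ofNat, ENNReal.coe_ofNat, ENNReal.rpow_ofNat] at h
  rw [h]
  exact lintegral_congr fun x => by rw [ENNReal.ofReal_pow (norm_nonneg _), ofReal_norm]

theorem MeasureTheory.MemLp.eLpNorm_two_sq_eq {X F : Type*} [MeasurableSpace X] [NormedAddCommGroup F]
    {μ : Measure X} {f : X → F} (hf : MemLp f 2 μ) :
    eLpNorm f 2 μ ^ 2 = ENNReal.ofReal (∫ x, ‖f x‖ ^ 2 ∂μ) := by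
  rw [eLpNorm_two_sq, ofReal_integral_eq_lintegral_ofReal hf.norm.integrable_sq
    (ae_of_all _ fun x => by positivity)]

theorem tendsto_eLpNorm_of_tendsto_eLpNorm_sub {X F : Type*} [MeasurableSpace X]
    [NormedAddCommGroup F] {μ : Measure X} {p : ℝ≥0∞} (hp : 1 ≤ p) {φ : ℕ → X → F} {f : X → F}
    (hφ : ∀ n, AEStronglyMeasurable (φ n) μ) (hf : MemLp f p μ)
    (h : Tendsto (fun n => eLpNorm (φ n - f) p μ) atTop (𝓝 0)) :
    Tendsto (fun n => eLpNorm (φ n) p μ) atTop (𝓝 (eLpNorm f p μ)) := by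
  have h1 : Tendsto (fun n => eLpNorm f p μ - eLpNorm (φ n - f) p μ) atTop
      (𝓝 (eLpNorm f p μ - 0)) :=
    ENNReal.Tendsto.sub tendsto_const_nhds h (Or.inl hf.eLpNorm_ne_top)
  have h2 : Tendsto (fun n => eLpNorm f p μ + eLpNorm (φ n - f) p μ) atTop
      (𝓝 (eLpNorm f p μ + 0)) := tendsto_const_nhds.add h
  rw [tsub_zero] at h1
  rw [add_zero] at h2
  refine tendsto_of_tendsto_of_tendsto_of_le_of_le h1 h2 (fun n => ?_) fun n => ?_
  · rw [tsub_le_iff_right]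
    have := eLpNorm_sub_le (hφ n) ((hφ n).sub hf.1) hp
    rwa [sub_sub_cancel] at this
  · have := eLpNorm_add_le hf.1 ((hφ n).sub hf.1) hp
    rwa [add_sub_cancel] at this

/-- Young's inequality `2 β M |φ| |∇φ| ≤ β² M² |φ|² + |∇φ|²`, weighted so that the Dirichlet term
has coefficient exactly one, as in the Robin form. -/
theorem eLpNorm_surfaceMeasure_le {C M : ℝ} (hC : 0 ≤ C) {φ : EuclideanSpace ℝ (Fin d) → ℂ}
    (hφ : ContDiff ℝ ∞ φ)
    (h : ∫⁻ y, ENNReal.ofReal (‖φ y‖ ^ 2) ∂(surfaceMeasure Ω) ≤ ∫⁻ x in Ω, ENNReal.ofReal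
        (C * ‖φ x‖ ^ 2 + 2 * M * ‖φ x‖ * √(∑ i, ‖partialDeriv i φ x‖ ^ 2)))
    {β : ℝ} (hβ : 0 ≤ β) :
    ENNReal.ofReal β * eLpNorm φ 2 (surfaceMeasure Ω) ^ 2 ≤
      ENNReal.ofReal (β * C + β ^ 2 * M ^ 2) * eLpNorm φ 2 (volume.restrict Ω) ^ 2 +
        ∑ i, eLpNorm (partialDeriv i φ) 2 (volume.restrict Ω) ^ 2 := by
  have hφ1 : ContDiff ℝ 1 φ := hφ.of_le (by exact_mod_cast le_top)
  have hpc : ∀ i, Continuous (partialDeriv i φ) := fun i =>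
    (hφ1.continuous_fderiv one_ne_zero).clm_apply continuous_const
  have hφc : Continuous φ := hφ.continuous
  have hm : Measurable fun x => ENNReal.ofReal (‖φ x‖ ^ 2) :=
    (ENNReal.continuous_ofReal.comp (by fun_prop)).measurable
  have hm' : ∀ i, Measurable fun x => ENNReal.ofReal (‖partialDeriv i φ x‖ ^ 2) := fun i =>
    (ENNReal.continuous_ofReal.comp (by have := hpc i; fun_prop)).measurable
  simp_rw [eLpNorm_two_sq]
  refine (mul_le_mul_right h _).trans ?_
  rw [← lintegral_const_mul _ hm, ← lintegral_finsetSum _ fun i _ => hm' i,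
    ← lintegral_add_left (hm.const_mul _), ← lintegral_const_mul']
  · refine lintegral_mono fun x => ?_
    rw [← ENNReal.ofReal_mul hβ, ← ENNReal.ofReal_mul (by positivity),
      ← ENNReal.ofReal_sum_of_nonneg (fun i _ => by positivity),
      ← ENNReal.ofReal_add (by positivity) (by positivity)]
    refine ENNReal.ofReal_le_ofReal ?_
    have hG : √(∑ i, ‖partialDeriv i φ x‖ ^ 2) ^ 2 = ∑ i, ‖partialDeriv i φ x‖ ^ 2 :=
      Real.sq_sqrt (by positivity)
    generalize √(∑ i, ‖partialDeriv i φ x‖ ^ 2) = s at hG ⊢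
    rw [← hG]
    nlinarith [sq_nonneg (β * M * ‖φ x‖ - s)]
  · exact ENNReal.ofReal_ne_top

/-- All three kinds of `L²` norms converge along the smooth sequence defining the trace, so the
inequality for smooth functions survives in the limit. -/
theorem IsTrace.integral_norm_sq_le {C M : ℝ} (hC : 0 ≤ C)
    (h : ∀ φ : EuclideanSpace ℝ (Fin d) → ℂ, ContDiff ℝ ∞ φ →
      ∫⁻ y, ENNReal.ofReal (‖φ y‖ ^ 2) ∂(surfaceMeasure Ω) ≤ ∫⁻ x in Ω, ENNReal.ofReal
        (C * ‖φ x‖ ^ 2 + 2 * M * ‖φ x‖ * √(∑ i, ‖partialDeriv i φ x‖ ^ 2)))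
    {u : SobolevH1 Ω} {g : EuclideanSpace ℝ (Fin d) → ℂ} (hg : IsTrace u g) {β : ℝ} (hβ : 0 ≤ β) :
    β * ∫ y, ‖g y‖ ^ 2 ∂(surfaceMeasure Ω) ≤
      (β * C + β ^ 2 * M ^ 2) * (∫ x in Ω, ‖u.val x‖ ^ 2) +
        ∑ i, ∫ x in Ω, ‖u.grad i x‖ ^ 2 := by
  obtain ⟨hgm, φ, hφ, hφu, hφi, hφg⟩ := hg
  have hpc : ∀ n i, Continuous (partialDeriv i (φ n)) := fun n i =>
    (((hφ n).of_le (m := 1) (by exact_mod_cast le_top)).continuous_fderiv one_ne_zero).clm_apply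
      continuous_const
  have hl := tendsto_eLpNorm_of_tendsto_eLpNorm_sub one_le_two
    (fun n => (hφ n).continuous.aestronglyMeasurable) hgm hφg
  have hu := tendsto_eLpNorm_of_tendsto_eLpNorm_sub one_le_two
    (fun n => (hφ n).continuous.aestronglyMeasurable) u.memLp_val hφu
  have hi := fun i => tendsto_eLpNorm_of_tendsto_eLpNorm_sub one_le_two
    (fun n => (hpc n i).aestronglyMeasurable) (u.memLp_grad i) (hφi i)
  have hlim := le_of_tendsto_of_tendsto'
    (ENNReal.Tendsto.const_mul (ENNReal.Tendsto.pow hl) (Or.inr ENNReal.ofReal_ne_top))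
    ((ENNReal.Tendsto.const_mul (ENNReal.Tendsto.pow hu) (Or.inr ENNReal.ofReal_ne_top)).add
      (tendsto_finsetSum Finset.univ fun i _ => ENNReal.Tendsto.pow (hi i)))
    fun n => eLpNorm_surfaceMeasure_le hC (hφ n) (h _ (hφ n)) hβ
  rw [hgm.eLpNorm_two_sq_eq, u.memLp_val.eLpNorm_two_sq_eq,
    Finset.sum_congr rfl fun i _ => (u.memLp_grad i).eLpNorm_two_sq_eq,
    ← ENNReal.ofReal_sum_of_nonneg fun i _ => integral_nonneg fun x => by positivity,
    ← ENNReal.ofReal_mul hβ, ← ENNReal.ofReal_mul (by positivity)] at hlim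
  have hN : 0 ≤ ∫ x in Ω, ‖u.val x‖ ^ 2 := integral_nonneg fun x => by positivity
  have hD : 0 ≤ ∑ i, ∫ x in Ω, ‖u.grad i x‖ ^ 2 :=
    Finset.sum_nonneg fun i _ => integral_nonneg fun x => by positivity
  rwa [← ENNReal.ofReal_add (by positivity) hD, ENNReal.ofReal_le_ofReal_iff (by positivity)]
    at hlim

theorem robinForm_self (α : ℝ) (u : SobolevH1 Ω) (g : EuclideanSpace ℝ (Fin d) → ℂ) :
    robinForm α u u g g =
      (((∑ i, ∫ x in Ω, ‖u.grad i x‖ ^ 2) + α * ∫ y, ‖g y‖ ^ 2 ∂(surfaceMeasure Ω) : ℝ) : ℂ) := by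
  have h1 : ∀ z : ℂ, z * conj z = ((‖z‖ ^ 2 : ℝ) : ℂ) := fun z => by
    rw [Complex.mul_conj, Complex.normSq_eq_norm_sq]
  rw [robinForm]
  simp_rw [mul_assoc, h1, ← Complex.ofReal_sum, ← Complex.ofReal_mul]
  rw [integral_complex_ofReal, integral_complex_ofReal, integral_const_mul,
    integral_finsetSum _ fun i _ => (u.memLp_grad i).norm.integrable_sq]
  push_cast
  rfl

theorem IsRobinEigenvalue.bound {C M : ℝ} (hC : 0 ≤ C)
    (h : ∀ φ : EuclideanSpace ℝ (Fin d) → ℂ, ContDiff ℝ ∞ φ →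
      ∫⁻ y, ENNReal.ofReal (‖φ y‖ ^ 2) ∂(surfaceMeasure Ω) ≤ ∫⁻ x in Ω, ENNReal.ofReal
        (C * ‖φ x‖ ^ 2 + 2 * M * ‖φ x‖ * √(∑ i, ‖partialDeriv i φ x‖ ^ 2)))
    {α : ℝ} (hα : α < 0) {lam : ℂ} (hlam : IsRobinEigenvalue Ω (α : ℂ) lam) :
    lam.im = 0 ∧ lam.re ≥ -M ^ 2 * α ^ 2 + C * α := by
  obtain ⟨u, hu, -, g, hg, huv⟩ := hlam
  -- Testing with the eigenfunction and its own trace makes the form real, and `‖u‖² > 0` then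
  -- forces `lam` to be real.
  have h1 := huv u g hg
  set N := ∫ x in Ω, ‖u.val x‖ ^ 2 with hN
  have hN0 : 0 < N := by
    refine lt_of_le_of_ne (integral_nonneg fun x => by positivity) fun h0 => hu ?_
    have h2 := (integral_eq_zero_iff_of_nonneg (fun x => by positivity)
      u.memLp_val.norm.integrable_sq).1 h0.symm
    filter_upwards [h2] with x hx
    simpa using hx
  have h3 : ∫ x in Ω, lam * u.val x * conj (u.val x) = lam * (N : ℂ) := by
    simp_rw [mul_assoc, Complex.mul_conj, Complex.normSq_eq_norm_sq]
    rw [integral_const_mul, integral_complex_ofReal]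
  rw [robinForm_self, h3] at h1
  have him := congrArg Complex.im h1
  have hre := congrArg Complex.re h1
  rw [Complex.ofReal_im, Complex.im_mul_ofReal] at him
  rw [Complex.ofReal_re, Complex.re_mul_ofReal] at hre
  have h4 := hg.integral_norm_sq_le hC h (β := -α) (by linarith)
  refine ⟨(mul_eq_zero.1 him.symm).resolve_right hN0.ne', ?_⟩
  refine le_of_mul_le_mul_right ?_ hN0
  rw [← hre]
  linarith

end Trace

theorem corollary1p4 (d : ℕ) (hd : 2 ≤ d) (Ω : Set (EuclideanSpace ℝ (Fin d)))
    (hΩ : IsBoundedLipschitzDomain Ω) :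
    (∃ c₁ c₂ : ℝ, 1 ≤ c₁ ∧ 0 < c₂ ∧
      ∀ α : ℝ, α < 0 → ∀ lam : ℂ, IsRobinEigenvalue Ω (α : ℂ) lam →
        lam.im = 0 ∧ lam.re ≥ -c₁ * α ^ 2 + c₂ * α) ∧
    (HasC2Boundary Ω →
      ∃ c₂ : ℝ, 0 < c₂ ∧
        ∀ α : ℝ, α < 0 → ∀ lam : ℂ, IsRobinEigenvalue Ω (α : ℂ) lam →
          lam.im = 0 ∧ lam.re ≥ -α ^ 2 + c₂ * α) := by
  refine ⟨?_, fun hC2 => ?_⟩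
  · obtain ⟨C, hC, M, -, h⟩ := exists_trace_inequality hΩ.isBounded (Q := Set.univ) trivial
      (fun _ _ _ _ => trivial) fun z hz => by
        obtain ⟨U, hU, hzU, C, M, hCM⟩ :=
          exists_localTraceBound_of_lipschitz hΩ.isOpen hΩ.lipschitz_boundary hz
        exact ⟨U, hU, hzU, C, M, trivial, hCM⟩
    -- The added ones only secure `c₁ ≥ 1` and `c₂ > 0`; for `α < 0` both weaken the bound.
    refine ⟨1 + M ^ 2, C + 1, by nlinarith [sq_nonneg (M : ℝ)], by linarith,
      fun α hα lam hlam => ?_⟩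
    obtain ⟨him, hre⟩ := hlam.bound hC h hα
    exact ⟨him, by nlinarith [sq_nonneg α]⟩
  · obtain ⟨C, hC, M, hM, h⟩ := exists_trace_inequality hΩ.isBounded (Q := Set.Iic 1)
      (Set.mem_Iic.2 zero_le_one) (fun _ ha _ hb => Set.mem_Iic.2 (sup_le ha hb)) fun z hz => by
        obtain ⟨U, hU, hzU, C, hCM⟩ := exists_localTraceBound_of_C2 hΩ.isOpen hC2 hz
        exact ⟨U, hU, hzU, C, 1, Set.mem_Iic.2 le_rfl, hCM⟩
    refine ⟨C + 1, by linarith, fun α hα lam hlam => ?_⟩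
    obtain ⟨him, hre⟩ := hlam.bound hC h hα
    have hM1 : (M : ℝ) ^ 2 ≤ 1 := pow_le_one₀ M.2 hM
    exact ⟨him, by nlinarith [mul_le_mul_of_nonneg_right hM1 (sq_nonneg α)]⟩
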